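/- For $k\in\mathbb Z$ let $\mathcal U_k\subset\mathbb A^3_{\mathbb Z}$ be the affine scheme defined by $$x^2+y^2+z^2-4(x^2y^2+y^2z^2+z^2x^2)+16x^2y^2z^2=k,$$ and let $U_k=\mathcal U_k\times_{\mathbb Z}\mathbb Q$. On $U_k$ one has $(4x^2-1)(4y^2-1)(4z^2-1)=4k-1\neq 0$, so that $4x^2-1$ is an invertible function on $U_k$; for $k\ne 0$ let $\mathcal A_1=(4x^2-1,k)\in\mathrm{Br}\,U_k$ be the class of the corresponding quaternion algebra. Put $\mathcal U_k(\mathbf A_{\mathbb Z})=\prod_p\mathcal U_k(\mathbb Z_p)\times U_k(\mathbb R)$ and let $\mathcal U_k(\mathbf A_{\mathbb Z})^{\mathcal A_1}$ be the set of those $(P_v)_v\in\mathcal U_k(\mathbf A_{\mathbb Z})$ for which $$\sum_{v\le\infty}\mathrm{inv}_v\,\mathcal A_1(P_v)=0\in\mathbb Q/\mathbb Z,$$ where $\mathrm{inv}_v$ is the local invariant at the place $v$ (equal to $0$ or $\tfrac12$ according as the quaternion algebra $\mathcal A_1(P_v)$ over $\mathbb Q_v$ is split or not). **Proposition.** (1)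 Let $k\equiv 2 \pmod 8$ and suppose that $\mathcal U_k(\mathbb Z)\neq\emptyset$. Then there is a Brauer--Manin obstruction to strong approximation on $\mathcal U_k$ with respect to $\mathcal A_1$: for every point of $\mathcal U_k(\mathbf A_{\mathbb Z})$ only finitely many of the local invariants are non-zero, and $$\mathcal U_k(\mathbf A_{\mathbb Z})^{\mathcal A_1}\neq\mathcal U_k(\mathbf A_{\mathbb Z}).$$ The same holds if $U_k(\mathbb R)$ is replaced by its set of connected components, that is, the image of $\mathcal U_k(\mathbf A_{\mathbb Z})^{\mathcal A_1}$ in $\prod_p\mathcal U_k(\mathbb Z_p)\times\pi_0(U_k(\mathbb R))$ is not the whole set. (2) An example in (1) is $k=34\equiv 2\pmod 8$, with integral point $(1,1,2)\in\mathcal U_{34}(\mathbb Z)$. (3) The conclusions of (1) also hold for $k=574$ (which is $\equiv 6\pmod 8$), with integral point $(1,1,8)\in\mathcal U_{574}(\mathbb Z)$. -/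

import Mathlib

open scoped Quaternion

noncomputable section

namespace MarkoffK3

instance factPrime (p : Nat.Primes) : Fact (p : ℕ).Prime := ⟨p.2⟩

/-- The polynomial `x² + y² + z² - 4(x²y² + y²z² + z²x²) + 16x²y²z²`, evaluated in a commutative
ring. -/
def F2 {R : Type*} [CommRing R] (x y z : R) : R :=
  x ^ 2 + y ^ 2 + z ^ 2 - 4 * (x ^ 2 * y ^ 2 + y ^ 2 * z ^ 2 + z ^ 2 * x ^ 2)
    + 16 * (x ^ 2 * y ^ 2 * z ^ 2)

/-- The set `𝒰_k(R)` of `R`-points of the affine `ℤ`-scheme `𝒰_k : F₂(x, y, z) = k`. -/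
def Points (k : ℤ) (R : Type*) [CommRing R] : Set (Fin 3 → R) :=
  {v | F2 (v 0) (v 1) (v 2) = (k : R)}

theorem map_F2 {R S : Type*} [CommRing R] [CommRing S] (f : R →+* S) (x y z : R) :
    f (F2 x y z) = F2 (f x) (f y) (f z) := by
  simp only [F2, map_add, map_sub, map_mul, map_pow, map_ofNat]

/-- Functoriality `𝒰_k(R) → 𝒰_k(S)`. -/
def mapPoints {k : ℤ} {R S : Type*} [CommRing R] [CommRing S] (f : R →+* S)
    (P : Points k R) : Points k S :=
  ⟨fun i => f (P.1 i), by
    have h : F2 (P.1 0) (P.1 1) (P.1 2) = (k : R) := P.2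
    have h' := congrArg f h
    rwa [map_F2, map_intCast] at h'⟩

/-- The ideal `(F₂ - k)` of `ℚ[x, y, z]`. -/
def defIdeal (k : ℤ) : Ideal (MvPolynomial (Fin 3) ℚ) :=
  Ideal.span {F2 (MvPolynomial.X 0) (MvPolynomial.X 1) (MvPolynomial.X 2)
    - (k : MvPolynomial (Fin 3) ℚ)}

/-- The coordinate ring `ℚ[x, y, z] / (F₂ - k)` of the generic fibre `U_k`. -/
abbrev CoordRing (k : ℤ) : Type :=
  MvPolynomial (Fin 3) ℚ ⧸ defIdeal k

/-- The coordinate functions `x`, `y`, `z` on `U_k`. -/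
def coord (k : ℤ) (i : Fin 3) : CoordRing k :=
  Ideal.Quotient.mk (defIdeal k) (MvPolynomial.X i)

/-- Evaluation of regular functions on `U_k` at a `K`-point. -/
def evalAt {k : ℤ} {K : Type*} [CommRing K] [Algebra ℚ K] (P : Points k K) :
    CoordRing k →ₐ[ℚ] K :=
  Ideal.Quotient.liftₐ (defIdeal k) (MvPolynomial.aeval P.1) (by
    intro a ha
    have h : defIdeal k ≤ RingHom.ker (MvPolynomial.aeval (R := ℚ) P.1) := by
      rw [defIdeal, Ideal.span_singleton_le_iff_mem, RingHom.mem_ker, map_sub, map_intCast, sub_eq_zero]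
      have h0 := map_F2 (MvPolynomial.aeval (R := ℚ) P.1).toRingHom
        (MvPolynomial.X 0) (MvPolynomial.X 1) (MvPolynomial.X 2)
      have hP : F2 (P.1 0) (P.1 1) (P.1 2) = (k : K) := P.2
      simp only [AlgHom.toRingHom_eq_coe, RingHom.coe_coe, MvPolynomial.aeval_X] at h0
      rw [h0, hP]
    exact h ha)

theorem evalAt_coord {k : ℤ} {K : Type*} [CommRing K] [Algebra ℚ K] (P : Points k K)
    (i : Fin 3) : evalAt P (coord k i) = P.1 i := by
  exact MvPolynomial.aeval_X (R := ℚ) P.1 i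

theorem F2_coord (k : ℤ) :
    F2 (coord k 0) (coord k 1) (coord k 2) = (k : CoordRing k) := by
  have h := map_F2 (Ideal.Quotient.mk (defIdeal k))
    (MvPolynomial.X 0) (MvPolynomial.X 1) (MvPolynomial.X 2)
  have hk : Ideal.Quotient.mk (defIdeal k)
      (F2 (MvPolynomial.X 0) (MvPolynomial.X 1) (MvPolynomial.X 2))
      = Ideal.Quotient.mk (defIdeal k) (k : MvPolynomial (Fin 3) ℚ) := by
    rw [Ideal.Quotient.eq]
    exact Ideal.mem_span_singleton_self _
  rw [map_intCast] at hk
  exact h.symm.trans hk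

/-- A quaternion symbol `(a, b)` over a commutative ring `R`, with `a` and `b` units of `R`. -/
structure QuaternionSymbol (R : Type*) [CommRing R] where
  a : Rˣ
  b : Rˣ

namespace QuaternionSymbol

/-- Base change of a symbol; along evaluation at a point this is specialisation. -/
def map {R S : Type*} [CommRing R] [CommRing S] (A : QuaternionSymbol R) (f : R →+* S) :
    QuaternionSymbol S :=
  ⟨Units.map f A.a, Units.map f A.b⟩

/-- The quaternion algebra with `i² = a`, `j² = b`, `ij = -ji`. It is an Azumaya algebra when `2` is
invertible in `R`, and represents the class of `(a, b)` in the Brauer group of `R`. -/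
abbrev toAlgebra {R : Type*} [CommRing R] (A : QuaternionSymbol R) : Type _ :=
  ℍ[R, (A.a : R), (A.b : R)]

open Classical in
/-- The local invariant in `ℚ/ℤ` of the class of a quaternion algebra over `ℝ` or `ℚ_p`: this class
is killed by `2`, so the invariant is `0` when the algebra is split and `1/2` when it is not. -/
def localInv {K : Type*} [Field K] (A : QuaternionSymbol K) : AddCircle (1 : ℚ) :=
  if Nonempty (A.toAlgebra ≃ₐ[K] Matrix (Fin 2) (Fin 2) K) then 0
  else ((1 / 2 : ℚ) : AddCircle (1 : ℚ))

end QuaternionSymbol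

/-- `𝒰_k(𝐀_ℤ) = ∏_p 𝒰_k(ℤ_p) × 𝒰_k(ℝ)`. -/
abbrev AdelicPoints (k : ℤ) : Type :=
  (∀ p : Nat.Primes, Points k ℤ_[p]) × Points k ℝ

/-- `inv_p A(P_p)`, for the component `P_p` at a prime `p` of an adelic point. -/
def invAt {k : ℤ} (A : QuaternionSymbol (CoordRing k)) (P : AdelicPoints k) (p : Nat.Primes) :
    AddCircle (1 : ℚ) :=
  (A.map (evalAt (mapPoints (PadicInt.Coe.ringHom (p := p)) (P.1 p))).toRingHom).localInv

/-- `inv_∞ A(P_∞)`, for the real component of an adelic point. -/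
def invInfty {k : ℤ} (A : QuaternionSymbol (CoordRing k)) (P : AdelicPoints k) :
    AddCircle (1 : ℚ) :=
  (A.map (evalAt P.2).toRingHom).localInv

/-- The Brauer--Manin pairing, with values in `ℚ/ℤ`. -/
def pairing {k : ℤ} (A : QuaternionSymbol (CoordRing k)) (P : AdelicPoints k) :
    AddCircle (1 : ℚ) :=
  (∑ᶠ p : Nat.Primes, invAt A P p) + invInfty A P

/-- The Brauer--Manin set `𝒰_k(𝐀_ℤ)^A`. -/
def brauerManinSet {k : ℤ} (A : QuaternionSymbol (CoordRing k)) : Set (AdelicPoints k) :=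
  {P | pairing A P = 0}

/-- `∏_p 𝒰_k(ℤ_p) × π₀(U_k(ℝ))`. -/
abbrev AdelicPointsBullet (k : ℤ) : Type :=
  (∀ p : Nat.Primes, Points k ℤ_[p]) × ConnectedComponents (Points k ℝ)

/-- The projection `∏_p 𝒰_k(ℤ_p) × U_k(ℝ) → ∏_p 𝒰_k(ℤ_p) × π₀(U_k(ℝ))`. -/
def toBullet {k : ℤ} (P : AdelicPoints k) : AdelicPointsBullet k :=
  (P.1, (P.2 : ConnectedComponents (Points k ℝ)))

theorem four_mul_sub_one_mul (k : ℤ) :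
    (4 * coord k 0 ^ 2 - 1) * ((4 * coord k 1 ^ 2 - 1) * (4 * coord k 2 ^ 2 - 1))
      = algebraMap ℚ (CoordRing k) (4 * k - 1) := by
  have h := F2_coord k
  simp only [F2] at h
  simp only [map_sub, map_mul, map_intCast, map_ofNat, map_one]
  linear_combination 4 * h

theorem isUnit_four_mul_sq_sub_one (k : ℤ) : IsUnit (4 * coord k 0 ^ 2 - 1) := by
  refine isUnit_of_mul_isUnit_left (y := (4 * coord k 1 ^ 2 - 1) * (4 * coord k 2 ^ 2 - 1)) ?_
  rw [four_mul_sub_one_mul]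
  refine IsUnit.map _ (IsUnit.mk0 _ ?_)
  have h : (4 * k - 1 : ℤ) ≠ 0 := by omega
  exact_mod_cast h

theorem isUnit_intCast (k : ℤ) (hk : k ≠ 0) : IsUnit (k : CoordRing k) := by
  rw [← map_intCast (algebraMap ℚ (CoordRing k)) k]
  exact IsUnit.map _ (IsUnit.mk0 _ (by exact_mod_cast hk))

/-- The class `𝒜₁ = (4x² - 1, k)` in the Brauer group of `U_k`; both entries are invertible
functions on `U_k`. -/
def classA1 (k : ℤ) (hk : k ≠ 0) : QuaternionSymbol (CoordRing k) where
  a := (isUnit_four_mul_sq_sub_one k).unit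
  b := (isUnit_intCast k hk).unit

theorem ne_zero_of_modEq {k : ℤ} (hk : k ≡ 2 [ZMOD 8]) : k ≠ 0 := by
  rintro rfl
  exact absurd hk (by decide)

end MarkoffK3

end

/-! The equation is symmetric, so rotating the coordinates of one integral point gives others. For
`k ≡ 2` mod 8 a point has both odd and even coordinates (`parity_of_modEq`), so rotation puts either
parity in the `x` slot. Then `4x² - 1` is 3 or 7 mod 8. Over `ℚ₂` the first makes `(4x² - 1, k)`
non-split (`Padic.anisotropic_two`, through `QuaternionAlgebra.exists_isotropic`); the second makes
`4x² - 1 + k` a square, so the algebra splits. For `k = 574` the parities trade roles.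

Changing only the 2-adic component therefore changes the pairing, and two such adelic points cannot
both be orthogonal to the class (`obstruction`). As `k > 0`, the real invariant is identically 0,
which gives the version with connected components. The sum is finite by `invAt_eq_zero`. -/

/-! ### Squares and norms in `ℤ_p` -/

open Polynomial in
/-- Hensel's lemma for square roots. -/
theorem PadicInt.isSquare_of_norm_sq_sub_lt {p : ℕ} [Fact p.Prime] {w r : ℤ_[p]}
    (h : ‖r ^ 2 - w‖ < ‖2 * r‖ ^ 2) : ∃ s : ℤ_[p], s ^ 2 = w := by
  have hF : ‖(X ^ 2 - C w : ℤ_[p][X]).aeval r‖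
      < ‖(X ^ 2 - C w : ℤ_[p][X]).derivative.aeval r‖ ^ 2 := by
    simpa [one_add_one_eq_two] using h
  obtain ⟨z, hz, -⟩ := hensels_lemma hF
  refine ⟨z, ?_⟩
  simpa [sub_eq_zero] using hz

theorem PadicInt.toZMod_eq_zero_iff {p : ℕ} [Fact p.Prime] (x : ℤ_[p]) :
    PadicInt.toZMod x = 0 ↔ ‖x‖ < 1 := by
  rw [← RingHom.mem_ker, PadicInt.ker_toZMod, IsLocalRing.mem_maximalIdeal,
    PadicInt.mem_nonunits]

/-- For odd `p`, a `p`-adic unit whose reduction is a square is a square. -/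
theorem PadicInt.exists_sq_eq_of_toZMod {p : ℕ} [Fact p.Prime] (hp : p ≠ 2) {w : ℤ_[p]}
    {r : ZMod p} (hr : r ^ 2 = PadicInt.toZMod w) (h0 : r ≠ 0) : ∃ s : ℤ_[p], s ^ 2 = w := by
  obtain ⟨t, rfl⟩ := ZMod.ringHom_surjective (PadicInt.toZMod (p := p)) r
  have h2 : (2 : ZMod p) ≠ 0 := by
    have : Fact (2 < p) := ⟨lt_of_le_of_ne (Fact.out : p.Prime).two_le hp.symm⟩
    exact Ring.two_ne_zero (by rwa [ZMod.ringChar_zmod_n])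
  apply PadicInt.isSquare_of_norm_sq_sub_lt (r := t)
  have h1 : ‖2 * t‖ = 1 := by
    refine le_antisymm (PadicInt.norm_le_one _) (not_lt.mp ?_)
    rw [← PadicInt.toZMod_eq_zero_iff, map_mul, map_ofNat]
    exact mul_ne_zero h2 h0
  rw [h1, one_pow, ← PadicInt.toZMod_eq_zero_iff, map_sub, map_pow, hr, sub_self]

/-- Pigeonhole: `n²` and `k + u m²` each take `(p + 1)/2` values, so they share one. -/
theorem ZMod.exists_sq_sub_mul_sq {p : ℕ} [Fact p.Prime] (hp : p ≠ 2) {u : ZMod p} (hu : u ≠ 0)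
    (k : ZMod p) : ∃ n m : ZMod p, n ^ 2 - u * m ^ 2 = k := by
  obtain ⟨n, m, h⟩ := FiniteField.exists_root_sum_quadratic
    (f := (Polynomial.X ^ 2 : Polynomial (ZMod p)))
    (g := Polynomial.C (-u) * Polynomial.X ^ 2 + Polynomial.C 0 * Polynomial.X
      + Polynomial.C (-k))
    (Polynomial.degree_X_pow 2) (Polynomial.degree_quadratic (neg_ne_zero.mpr hu))
    (by
      rw [ZMod.card]
      exact (Nat.Prime.eq_two_or_odd (Fact.out : p.Prime)).resolve_left hp)
  refine ⟨n, m, ?_⟩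
  simp at h
  linear_combination h

/-- For odd `p`, a `p`-adic unit is a norm from an unramified quadratic extension. -/
theorem PadicInt.exists_sq_sub_mul_sq {p : ℕ} [Fact p.Prime] (hp : p ≠ 2) {u k : ℤ_[p]}
    (hu : IsUnit u) (hk : IsUnit k) : ∃ n m : ℤ_[p], n ^ 2 - u * m ^ 2 = k := by
  have hu' := (hu.map (PadicInt.toZMod (p := p))).ne_zero
  have hk' := (hk.map (PadicInt.toZMod (p := p))).ne_zero
  obtain ⟨n, m, h⟩ := ZMod.exists_sq_sub_mul_sq hp hu' (PadicInt.toZMod k)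
  obtain ⟨m', rfl⟩ := ZMod.ringHom_surjective (PadicInt.toZMod (p := p)) m
  -- Hensel lifts only a nonzero root. If `n = 0`, then `m ≠ 0` since `k` is a unit, and `-k/u` is
  -- the square to lift.
  by_cases hn : n = 0
  · subst hn
    obtain ⟨v, hv⟩ := hu.exists_right_inv
    have hv' : PadicInt.toZMod u * PadicInt.toZMod v = 1 := by rw [← map_mul, hv, map_one]
    obtain ⟨s, hs⟩ := PadicInt.exists_sq_eq_of_toZMod hp (w := -k * v)
      (r := PadicInt.toZMod m') (by
        rw [map_mul, map_neg, ← h]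
        linear_combination -PadicInt.toZMod m' ^ 2 * hv') (by
        rintro h0
        rw [h0] at h
        apply hk'
        rw [← h]
        ring)
    exact ⟨0, s, by linear_combination -u * hs + k * hv⟩
  · obtain ⟨s, hs⟩ := PadicInt.exists_sq_eq_of_toZMod hp (w := k + u * m' ^ 2) (r := n) (by
      simp only [map_add, map_mul, map_pow]
      linear_combination h) hn
    exact ⟨s, m', by linear_combination hs⟩

/-- An integer congruent to `1` modulo `8` is a `2`-adic square. -/
theorem PadicInt.exists_sq_eq_of_modEq_one {w : ℤ} (hw : w % 8 = 1) :
    ∃ s : ℤ_[2], s ^ 2 = (w : ℤ_[2]) := by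
  apply PadicInt.isSquare_of_norm_sq_sub_lt (r := 1)
  -- Here `‖1 - w‖ ≤ 1/8 < 1/4 = ‖2‖²`.
  have h : ‖((1 - w : ℤ) : ℤ_[2])‖ ≤ (2 : ℕ) ^ (-(3 : ℕ) : ℤ) := by
    rw [PadicInt.norm_int_le_pow_iff_dvd]
    norm_num
    omega
  have h2 : ‖(2 : ℤ_[2])‖ = 2⁻¹ := by simpa using PadicInt.norm_p (p := 2)
  rw [mul_one, h2, one_pow]
  push_cast at h
  refine h.trans_lt ?_
  norm_num

/-! ### Anisotropy over `ℚ₂` -/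

/-- A nonzero vector over `ℚ_p` is a multiple of a primitive vector over `ℤ_p`. -/
theorem Padic.exists_primitive {p : ℕ} [Fact p.Prime] {ι : Type*} [Finite ι] (v : ι → ℚ_[p])
    (hv : v ≠ 0) :
    ∃ c : ℚ_[p], c ≠ 0 ∧ ∃ w : ι → ℤ_[p], (∀ i, v i = c * w i) ∧ ∃ i, w i = 1 := by
  obtain ⟨j, hj⟩ := Function.ne_iff.mp hv
  have : Nonempty ι := ⟨j⟩
  obtain ⟨i, hi⟩ := Finite.exists_max fun i => ‖v i‖
  have h0 : 0 < ‖v i‖ := (norm_pos_iff.mpr hj).trans_le (hi j)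
  have h0' : v i ≠ 0 := norm_pos_iff.mp h0
  refine ⟨v i, h0', fun l => ⟨v l / v i, ?_⟩, fun l => ?_, i, ?_⟩
  · rw [norm_div]
    exact div_le_one_of_le₀ (hi l) h0.le
  · exact (mul_div_cancel₀ (v l) h0').symm
  · exact Subtype.ext (div_self h0')

/-- Squares mod 16 are 0, 4, 1, 9, and a case check rules out any odd coordinate. Excluding the
value 1 suffices, since a primitive vector is scaled to have a coordinate equal to 1. -/
theorem ZMod.isotropic_mod_sixteen {u k x y z : ZMod 16}
    (huk : (u = 3 ∨ u = 11) ∧ (k = 2 ∨ k = 10) ∨ (u = 7 ∨ u = 15) ∧ (k = 6 ∨ k = 14))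
    (h : u * x ^ 2 + k * y ^ 2 = u * k * z ^ 2) : x ≠ 1 ∧ y ≠ 1 ∧ z ≠ 1 := by
  have hsq : ∀ t : ZMod 16, (t ^ 2 = 0 ∨ t ^ 2 = 4) ∧ t ≠ 1 ∨ t ^ 2 = 1 ∨ t ^ 2 = 9 := by decide
  rcases hsq x with ⟨hx | hx, hx'⟩ | hx | hx <;> rcases hsq y with ⟨hy | hy, hy'⟩ | hy | hy <;>
    rcases hsq z with ⟨hz | hz, hz'⟩ | hz | hz <;> rw [hx, hy, hz] at h <;>
    first
    | exact ⟨hx', hy', hz'⟩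
    | (exfalso
       rcases huk with ⟨rfl | rfl, rfl | rfl⟩ | ⟨rfl | rfl, rfl | rfl⟩ <;> revert h <;> decide)

/-- The form `u x² + k y² - u k z²` is anisotropic over `ℚ₂` for these residues. -/
theorem Padic.anisotropic_two {u k : ℤ} (huk : u % 8 = 3 ∧ k % 8 = 2 ∨ u % 8 = 7 ∧ k % 8 = 6)
    {x y z : ℚ_[2]} (h : (u : ℚ_[2]) * x ^ 2 + k * y ^ 2 = u * k * z ^ 2) :
    x = 0 ∧ y = 0 ∧ z = 0 := by
  by_contra h0
  obtain ⟨c, hc, w, hw, i, hi⟩ := Padic.exists_primitive ![x, y, z] (by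
    intro hv
    exact h0 ⟨congrFun hv 0, congrFun hv 1, congrFun hv 2⟩)
  have h1 : x = c * w 0 := hw 0
  have h2 : y = c * w 1 := hw 1
  have h3 : z = c * w 2 := hw 2
  have e : (u : ℤ_[2]) * w 0 ^ 2 + k * w 1 ^ 2 = u * k * w 2 ^ 2 := by
    apply Subtype.coe_injective
    push_cast
    apply mul_left_cancel₀ (pow_ne_zero 2 hc)
    rw [h1, h2, h3] at h
    linear_combination h
  have e' := congrArg (PadicInt.toZModPow (p := 2) 4) e
  simp only [map_add, map_mul, map_pow, map_intCast] at e'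
  have hmod : ∀ (a b : ℤ), a % 16 = b → (a : ZMod 16) = (b : ZMod 16) := by
    intro a b hab
    rw [ZMod.intCast_eq_intCast_iff, ← hab]
    exact (Int.mod_modEq a 16).symm
  have huk' : (((u : ZMod 16) = 3 ∨ (u : ZMod 16) = 11) ∧ ((k : ZMod 16) = 2 ∨ (k : ZMod 16) = 10))
      ∨ ((u : ZMod 16) = 7 ∨ (u : ZMod 16) = 15) ∧ ((k : ZMod 16) = 6 ∨ (k : ZMod 16) = 14) := by
    refine huk.imp (fun h => ⟨?_, ?_⟩) (fun h => ⟨?_, ?_⟩)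
    · exact (show u % 16 = 3 ∨ u % 16 = 11 by omega).imp (hmod u 3) (hmod u 11)
    · exact (show k % 16 = 2 ∨ k % 16 = 10 by omega).imp (hmod k 2) (hmod k 10)
    · exact (show u % 16 = 7 ∨ u % 16 = 15 by omega).imp (hmod u 7) (hmod u 15)
    · exact (show k % 16 = 6 ∨ k % 16 = 14 by omega).imp (hmod k 6) (hmod k 14)
  obtain ⟨n1, n2, n3⟩ := ZMod.isotropic_mod_sixteen huk' e'
  have hi' : PadicInt.toZModPow (p := 2) 4 (w i) = 1 := by rw [hi, map_one]
  fin_cases i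
  exacts [n1 hi', n2 hi', n3 hi']

/-! ### Split quaternion algebras -/

section QuaternionSplitting

variable {K : Type*} [Field K] {a b : K}

/-- The matrices `i = !![0, a; 1, 0]` and `j = !![n, -a m; m, -n]` satisfy the quaternion relations
when `b = n² - a m²`. -/
def QuaternionAlgebra.matrixBasis {n m : K} (h : b = n ^ 2 - a * m ^ 2) :
    QuaternionAlgebra.Basis (Matrix (Fin 2) (Fin 2) K) a 0 b where
  i := !![0, a; 1, 0]
  j := !![n, -(a * m); m, -n]
  k := !![a * m, -(a * n); n, -(a * m)]
  i_mul_i := by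
    ext i j
    fin_cases i <;> fin_cases j <;> simp
  j_mul_j := by
    subst h
    ext i j
    fin_cases i <;> fin_cases j <;> simp <;> ring
  i_mul_j := by
    ext i j
    fin_cases i <;> fin_cases j <;> simp
  j_mul_i := by
    ext i j
    fin_cases i <;> fin_cases j <;> simp <;> ring

/-- The diagonal entries determine `w` and the off-diagonal ones `x`; what remains is a linear
system in `y`, `z` of determinant `n² - a m² = b ≠ 0`. -/
theorem QuaternionAlgebra.matrixBasis_liftHom_injective (h2 : (2 : K) ≠ 0) (ha : a ≠ 0)
    (hb : b ≠ 0) {n m : K} (h : b = n ^ 2 - a * m ^ 2) :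
    Function.Injective (QuaternionAlgebra.matrixBasis h).liftHom := by
  rw [injective_iff_map_eq_zero]
  rintro ⟨w, x, y, z⟩ hq
  rw [QuaternionAlgebra.Basis.liftHom_apply, QuaternionAlgebra.Basis.lift] at hq
  have e00 := congrFun (congrFun hq 0) 0
  have e01 := congrFun (congrFun hq 0) 1
  have e10 := congrFun (congrFun hq 1) 0
  have e11 := congrFun (congrFun hq 1) 1
  simp [QuaternionAlgebra.matrixBasis, Matrix.algebraMap_matrix_apply] at e00 e01 e10 e11
  have hw : w = 0 := by
    apply mul_left_cancel₀ h2
    linear_combination e00 + e11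
  have hx : x = 0 := by
    apply mul_left_cancel₀ (mul_ne_zero h2 ha)
    linear_combination e01 + a * e10
  subst hw hx
  have hy : y = 0 := by
    apply mul_left_cancel₀ hb
    rw [h]
    linear_combination n * e00 - a * m * e10
  have hz : z = 0 := by
    apply mul_left_cancel₀ hb
    rw [h]
    linear_combination n * e10 - m * e00
  subst hy hz
  rfl

theorem QuaternionAlgebra.nonempty_algEquiv_matrix (h2 : (2 : K) ≠ 0) (ha : a ≠ 0) (hb : b ≠ 0)
    {n m : K} (h : b = n ^ 2 - a * m ^ 2) :
    Nonempty (ℍ[K, a, b] ≃ₐ[K] Matrix (Fin 2) (Fin 2) K) := by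
  have hinj := QuaternionAlgebra.matrixBasis_liftHom_injective h2 ha hb h
  refine ⟨AlgEquiv.ofBijective (QuaternionAlgebra.matrixBasis h).liftHom ⟨hinj, ?_⟩⟩
  refine (LinearMap.injective_iff_surjective_of_finrank_eq_finrank
    (f := (QuaternionAlgebra.matrixBasis h).liftHom.toLinearMap) ?_).mp hinj
  rw [QuaternionAlgebra.finrank_eq_four, Module.finrank_matrix]
  simp

/-- A split quaternion algebra contains a nonzero element of square zero, so that its pure norm form
is isotropic. -/
theorem QuaternionAlgebra.exists_isotropic (h2 : (2 : K) ≠ 0)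
    (e : ℍ[K, a, b] ≃ₐ[K] Matrix (Fin 2) (Fin 2) K) :
    ∃ x y z : K, a * x ^ 2 + b * y ^ 2 = a * b * z ^ 2 ∧ ¬ (x = 0 ∧ y = 0 ∧ z = 0) := by
  set q := e.symm !![0, 1; 0, 0] with hq
  have hq0 : q ≠ 0 := by
    intro h
    rw [hq, map_eq_zero_iff _ e.symm.injective] at h
    exact one_ne_zero (congrFun (congrFun h 0) 1)
  have hqq : q * q = 0 := by
    have hM : !![0, 1; 0, 0] * !![0, 1; 0, 0] = (0 : Matrix (Fin 2) (Fin 2) K) := by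
      ext i j
      fin_cases i <;> fin_cases j <;> simp
    rw [hq, ← map_mul, hM, map_zero]
  obtain ⟨w, x, y, z⟩ := q
  have er := congrArg QuaternionAlgebra.re hqq
  have ei := congrArg QuaternionAlgebra.imI hqq
  have ej := congrArg QuaternionAlgebra.imJ hqq
  have ek := congrArg QuaternionAlgebra.imK hqq
  simp at er ei ej ek
  -- The imaginary parts of `q²` are `2w` times those of `q`; if `w ≠ 0`, then `q` would be a scalar
  -- with `w² = 0`.
  have hcancel : ∀ t : K, w ≠ 0 → 2 * w * t = 0 → t = 0 := fun t hw ht =>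
    (mul_eq_zero.mp ht).resolve_left (mul_ne_zero h2 hw)
  have hw : w = 0 := by
    by_contra hw
    have hx := hcancel x hw (by linear_combination ei)
    have hy := hcancel y hw (by linear_combination ej)
    have hz := hcancel z hw (by linear_combination ek)
    subst hx hy hz
    exact hw (by simpa using er)
  subst hw
  refine ⟨x, y, z, by linear_combination er, ?_⟩
  rintro ⟨rfl, rfl, rfl⟩
  exact hq0 rfl

end QuaternionSplitting

namespace MarkoffK3

variable {k : ℤ}

/-! ### Local invariants of the class -/

section LocalInvariants

variable {K : Type*} [Field K]

theorem localInv_eq_zero [CharZero K] (A : QuaternionSymbol K) {n m : K}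
    (h : (A.b : K) = n ^ 2 - A.a * m ^ 2) : A.localInv = 0 :=
  if_pos (QuaternionAlgebra.nonempty_algEquiv_matrix two_ne_zero A.a.ne_zero A.b.ne_zero h)

theorem half_ne_zero : ((1 / 2 : ℚ) : AddCircle (1 : ℚ)) ≠ 0 := by
  rw [Ne, AddCircle.coe_eq_zero_iff]
  rintro ⟨n, hn⟩
  rw [zsmul_eq_mul, mul_one] at hn
  have h : ((2 * n : ℤ) : ℚ) = (1 : ℤ) := by
    push_cast
    linear_combination 2 * hn
  have := Int.cast_injective h
  omega

theorem localInv_ne_zero [CharZero K] (A : QuaternionSymbol K)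
    (h : ∀ x y z : K, (A.a : K) * x ^ 2 + A.b * y ^ 2 = A.a * A.b * z ^ 2 →
      x = 0 ∧ y = 0 ∧ z = 0) : A.localInv ≠ 0 := by
  have hA : ¬ Nonempty (A.toAlgebra ≃ₐ[K] Matrix (Fin 2) (Fin 2) K) := by
    rintro ⟨e⟩
    obtain ⟨x, y, z, hxyz, h0⟩ := QuaternionAlgebra.exists_isotropic two_ne_zero e
    exact h0 (h x y z hxyz)
  rw [QuaternionSymbol.localInv, if_neg hA]
  exact half_ne_zero

variable [Algebra ℚ K]

theorem classA1_map_a (hk : k ≠ 0) (P : Points k K) :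
    (((classA1 k hk).map (evalAt P).toRingHom).a : K) = 4 * P.1 0 ^ 2 - 1 := by
  change evalAt P (4 * coord k 0 ^ 2 - 1) = _
  rw [map_sub, map_mul, map_pow, evalAt_coord, map_one, map_ofNat]

theorem classA1_map_b (hk : k ≠ 0) (P : Points k K) :
    (((classA1 k hk).map (evalAt P).toRingHom).b : K) = k := by
  change evalAt P (k : CoordRing k) = _
  rw [map_intCast]

theorem localInv_classA1_eq_zero [CharZero K] (hk : k ≠ 0) (P : Points k K) {n m : K}
    (h : (k : K) = n ^ 2 - (4 * P.1 0 ^ 2 - 1) * m ^ 2) :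
    ((classA1 k hk).map (evalAt P).toRingHom).localInv = 0 :=
  localInv_eq_zero _ (by rw [classA1_map_a, classA1_map_b, h])

end LocalInvariants

theorem four_sq_sub_one_mul {R : Type*} [CommRing R] (P : Points k R) :
    (4 * P.1 0 ^ 2 - 1) * ((4 * P.1 1 ^ 2 - 1) * (4 * P.1 2 ^ 2 - 1)) = 4 * (k : R) - 1 := by
  have h : F2 (P.1 0) (P.1 1) (P.1 2) = (k : R) := P.2
  simp only [F2] at h
  linear_combination 4 * h

/-- At an odd prime not dividing `k` the algebra `(4x² - 1, k)` splits at every integral point. -/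
theorem invAt_eq_zero (hk : k ≠ 0) (P : AdelicPoints k) (p : Nat.Primes) (hp : (p : ℕ) ≠ 2)
    (hpk : ¬ (p : ℤ) ∣ k) : invAt (classA1 k hk) P p = 0 := by
  have hkn : ‖(k : ℤ_[p])‖ = 1 :=
    le_antisymm (PadicInt.norm_le_one _) (not_lt.mp (by rwa [PadicInt.norm_int_lt_one_iff_dvd]))
  suffices ∃ n m : ℤ_[p], n ^ 2 - (4 * (P.1 p).1 0 ^ 2 - 1) * m ^ 2 = (k : ℤ_[p]) by
    obtain ⟨n, m, h⟩ := this
    refine localInv_classA1_eq_zero hk _ (n := n) (m := m) ?_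
    have h' := congrArg (PadicInt.Coe.ringHom (p := p)) h
    rw [map_intCast] at h'
    rw [← h']
    simp only [map_sub, map_mul, map_pow, map_one, map_ofNat]
    rfl
  by_cases hu : IsUnit (4 * (P.1 p).1 0 ^ 2 - 1)
  · exact PadicInt.exists_sq_sub_mul_sq hp hu (PadicInt.isUnit_iff.mpr hkn)
  -- If `p` divides `4x² - 1`, it divides `4k - 1`, so `k` reduces to the square of `1/2`.
  · have h0 : PadicInt.toZMod (4 * (P.1 p).1 0 ^ 2 - 1) = 0 := by
      rwa [PadicInt.toZMod_eq_zero_iff, ← PadicInt.not_isUnit_iff]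
    have h := congrArg PadicInt.toZMod (four_sq_sub_one_mul (P.1 p))
    rw [map_mul, h0, zero_mul] at h
    simp only [map_sub, map_mul, map_ofNat, map_one] at h
    have h4 : (2 : ZMod p) * (2 * PadicInt.toZMod (k : ℤ_[p])) = 1 := by linear_combination -h
    have h2 : (2 : ZMod p) ≠ 0 := left_ne_zero_of_mul_eq_one h4
    obtain ⟨s, hs⟩ := PadicInt.exists_sq_eq_of_toZMod hp (w := (k : ℤ_[p])) (r := (2 : ZMod p)⁻¹)
      (by
        rw [inv_pow]
        apply inv_eq_of_mul_eq_one_right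
        linear_combination h4) (inv_ne_zero h2)
    exact ⟨s, 0, by linear_combination hs⟩

theorem finite_invAt_ne_zero (hk : k ≠ 0) (P : AdelicPoints k) :
    {p : Nat.Primes | invAt (classA1 k hk) P p ≠ 0}.Finite := by
  have hfin : ((2 * k).natAbs.divisors : Set ℕ).Finite := Finset.finite_toSet _
  refine (hfin.preimage (f := fun p : Nat.Primes => (p : ℕ))
    Nat.Primes.coe_nat_injective.injOn).subset ?_
  intro p hp
  have h2k : (p : ℕ) ∣ (2 * k).natAbs := by
    rw [← Int.natCast_dvd]
    by_cases h2 : (p : ℕ) = 2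
    · exact ⟨k, by rw [h2]; rfl⟩
    · by_contra hd
      exact hp (invAt_eq_zero hk P p h2 fun h => hd (h.mul_left 2))
  simp [h2k, hk]

theorem invInfty_eq_zero (hk : k ≠ 0) (hpos : 0 < k) (P : AdelicPoints k) :
    invInfty (classA1 k hk) P = 0 := by
  refine localInv_classA1_eq_zero hk P.2 (n := √(k : ℝ)) (m := 0) ?_
  rw [Real.sq_sqrt (by exact_mod_cast hpos.le)]
  ring

/-! ### Varying the 2-adic component -/

/-- The prime `2`. -/
def primeTwo : Nat.Primes := ⟨2, Nat.prime_two⟩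

/-- The image of an integral point in `𝒰_k(ℤ_p)`. -/
noncomputable def toPadic (Q : Points k ℤ) (p : Nat.Primes) : Points k ℤ_[p] :=
  mapPoints (Int.castRingHom ℤ_[p]) Q

theorem mapPoints_toPadic (Q : Points k ℤ) (p : Nat.Primes) (i : Fin 3) :
    (mapPoints (PadicInt.Coe.ringHom (p := p)) (toPadic Q p)).1 i = (Q.1 i : ℚ_[p]) :=
  map_intCast (PadicInt.Coe.ringHom (p := p)) (Q.1 i)

theorem invAt_two_eq_zero (hk : k ≠ 0) (P : AdelicPoints k) (Q : Points k ℤ)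
    (hP : P.1 primeTwo = toPadic Q primeTwo) (h : (4 * Q.1 0 ^ 2 - 1 + k) % 8 = 1) :
    invAt (classA1 k hk) P primeTwo = 0 := by
  obtain ⟨s, hs⟩ := PadicInt.exists_sq_eq_of_modEq_one h
  have h' : (k : ℚ_[2]) = (s : ℚ_[2]) ^ 2 - (4 * (Q.1 0 : ℚ_[2]) ^ 2 - 1) * 1 ^ 2 := by
    have h' := congrArg (PadicInt.Coe.ringHom (p := 2)) hs
    rw [map_intCast, map_pow] at h'
    change (s : ℚ_[2]) ^ 2 = _ at h'
    rw [h']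
    push_cast
    ring
  refine localInv_classA1_eq_zero hk _ (n := (s : ℚ_[2])) (m := 1) ?_
  rw [hP, mapPoints_toPadic]
  exact h'

theorem invAt_two_ne_zero (hk : k ≠ 0) (P : AdelicPoints k) (Q : Points k ℤ)
    (hP : P.1 primeTwo = toPadic Q primeTwo)
    (h : (4 * Q.1 0 ^ 2 - 1) % 8 = 3 ∧ k % 8 = 2 ∨ (4 * Q.1 0 ^ 2 - 1) % 8 = 7 ∧ k % 8 = 6) :
    invAt (classA1 k hk) P primeTwo ≠ 0 := by
  refine localInv_ne_zero _ fun x y z hxyz => Padic.anisotropic_two h (x := x) (y := y) (z := z) ?_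
  rw [classA1_map_a, classA1_map_b, hP, mapPoints_toPadic] at hxyz
  push_cast
  exact hxyz

/-- The adelic point given by an integral point `Q`, with `2`-adic component replaced by that of the
integral point `Q'`. -/
noncomputable def adelicPoint (Q Q' : Points k ℤ) : AdelicPoints k :=
  (fun p => if p = primeTwo then toPadic Q' p else toPadic Q p,
    mapPoints (Int.castRingHom ℝ) Q)

theorem adelicPoint_apply_two (Q Q' : Points k ℤ) :
    (adelicPoint Q Q').1 primeTwo = toPadic Q' primeTwo :=
  if_pos (c := primeTwo = primeTwo) (e := toPadic Q primeTwo) rfl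

theorem adelicPoint_apply_of_ne (Q Q' : Points k ℤ) {p : Nat.Primes} (hp : p ≠ primeTwo) :
    (adelicPoint Q Q').1 p = toPadic Q p :=
  if_neg hp

/-- The real components may differ, as `k > 0` makes the real invariants vanish. Finite supports
allow termwise subtraction. -/
theorem pairing_sub_pairing (hk : k ≠ 0) (hpos : 0 < k) {P P' : AdelicPoints k}
    (h : ∀ p ≠ primeTwo, P.1 p = P'.1 p) :
    pairing (classA1 k hk) P - pairing (classA1 k hk) P'
      = invAt (classA1 k hk) P primeTwo - invAt (classA1 k hk) P' primeTwo := by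
  rw [pairing, pairing, invInfty_eq_zero hk hpos, invInfty_eq_zero hk hpos, add_zero, add_zero,
    ← finsum_sub_distrib (finite_invAt_ne_zero hk P) (finite_invAt_ne_zero hk P')]
  apply finsum_eq_single
  intro p hp
  simp only [invAt, h p hp, sub_self]

/-- If `Q` and `Q'` are integral points where the invariant at `2` takes different values, there is a
Brauer--Manin obstruction to strong approximation. -/
theorem obstruction (hk : k ≠ 0) (hpos : 0 < k) (Q Q' : Points k ℤ)
    (h : (4 * Q.1 0 ^ 2 - 1) % 8 = 3 ∧ k % 8 = 2 ∨ (4 * Q.1 0 ^ 2 - 1) % 8 = 7 ∧ k % 8 = 6)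
    (h' : (4 * Q'.1 0 ^ 2 - 1 + k) % 8 = 1) :
    (∀ P : AdelicPoints k, {p : Nat.Primes | invAt (classA1 k hk) P p ≠ 0}.Finite) ∧
      brauerManinSet (classA1 k hk) ≠ Set.univ ∧
      toBullet '' brauerManinSet (classA1 k hk) ≠ Set.univ := by
  have key : toBullet '' brauerManinSet (classA1 k hk) ≠ Set.univ := by
    intro hu
    obtain ⟨P, hP, hPQ⟩ := hu.ge (Set.mem_univ (toBullet (adelicPoint Q Q)))
    obtain ⟨P', hP', hPQ'⟩ := hu.ge (Set.mem_univ (toBullet (adelicPoint Q Q')))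
    -- The real components of `P` and `P'` are known only up to connected component; the finite ones
    -- are all that is needed.
    have e : P.1 = (adelicPoint Q Q).1 := (Prod.ext_iff.mp hPQ).1
    have e' : P'.1 = (adelicPoint Q Q').1 := (Prod.ext_iff.mp hPQ').1
    have hsub := pairing_sub_pairing hk hpos (P := P) (P' := P') fun p hp => by
      rw [e, e', adelicPoint_apply_of_ne Q Q hp, adelicPoint_apply_of_ne Q Q' hp]
    rw [show pairing _ P = 0 from hP, show pairing _ P' = 0 from hP',
      invAt_two_eq_zero hk P' Q' (by rw [e', adelicPoint_apply_two]) h',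
      sub_zero, sub_zero] at hsub
    exact invAt_two_ne_zero hk P Q (by rw [e, adelicPoint_apply_two]) h hsub.symm
  refine ⟨finite_invAt_ne_zero hk, fun hu => key ?_, key⟩
  rw [hu, Set.image_univ, Set.range_eq_univ]
  rintro ⟨f, c⟩
  obtain ⟨r, rfl⟩ := ConnectedComponents.surjective_coe c
  exact ⟨(f, r), rfl⟩

/-! ### Parity and sign of integral points -/

theorem four_sq_sub_one_emod_of_even {a : ℤ} (h : Even a) : (4 * a ^ 2 - 1) % 8 = 7 := by
  obtain ⟨b, rfl⟩ := h
  ring_nf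
  omega

theorem four_sq_sub_one_emod_of_odd {a : ℤ} (h : Odd a) : (4 * a ^ 2 - 1) % 8 = 3 := by
  obtain ⟨b, rfl⟩ := h
  ring_nf
  omega

/-- The point obtained by rotating the coordinates cyclically by `i` places. -/
def permPoints {R : Type*} [CommRing R] (P : Points k R) (i : Fin 3) : Points k R :=
  ⟨![P.1 i, P.1 (i + 1), P.1 (i + 2)], by
    have h : F2 (P.1 0) (P.1 1) (P.1 2) = (k : R) := P.2
    change F2 (P.1 i) (P.1 (i + 1)) (P.1 (i + 2)) = (k : R)
    rw [← h]
    fin_cases i <;> simp [F2] <;> ring⟩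

/-- For `k ≡ 2 (mod 8)` an integral point has odd and even coordinates, and none of them is zero. -/
theorem parity_of_modEq (hk : k % 8 = 2) (P : Points k ℤ) :
    (∃ i, Odd (P.1 i)) ∧ (∃ i, Even (P.1 i)) ∧ ∀ i, P.1 i ≠ 0 := by
  obtain ⟨v, hv⟩ := P
  have h : F2 (v 0) (v 1) (v 2) = k := hv
  -- In `ZMod 8`, `4x = 0` expresses that `x` is even.
  have h8 : ∀ x y z : ZMod 8, F2 x y z = 2 →
      (4 * x ≠ 0 ∨ 4 * y ≠ 0 ∨ 4 * z ≠ 0) ∧ (4 * x = 0 ∨ 4 * y = 0 ∨ 4 * z = 0) ∧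
        x ≠ 0 ∧ y ≠ 0 ∧ z ≠ 0 := by
    unfold F2
    decide
  have hcast := congrArg (Int.castRingHom (ZMod 8)) h
  rw [map_F2] at hcast
  have hk8 : (k : ZMod 8) = 2 := by
    rw [← Int.cast_ofNat (R := ZMod 8) 2, ZMod.intCast_eq_intCast_iff]
    exact hk
  simp only [eq_intCast, hk8] at hcast
  obtain ⟨ho, he, h0, h1, h2⟩ := h8 _ _ _ hcast
  have heven : ∀ a : ℤ, 4 * (a : ZMod 8) = 0 ↔ Even a := by
    intro a
    have h4 : 4 * (a : ZMod 8) = ((4 * a : ℤ) : ZMod 8) := by push_cast; rfl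
    rw [h4, ZMod.intCast_zmod_eq_zero_iff_dvd, even_iff_two_dvd]
    push_cast
    omega
  simp only [Ne, heven, Int.not_even_iff_odd] at ho he
  refine ⟨?_, ?_, ?_⟩
  · rcases ho with h | h | h
    exacts [⟨0, h⟩, ⟨1, h⟩, ⟨2, h⟩]
  · rcases he with h | h | h
    exacts [⟨0, h⟩, ⟨1, h⟩, ⟨2, h⟩]
  · intro i hi
    have hi' : ((v i : ℤ) : ZMod 8) = 0 := by rw [show v i = 0 from hi, Int.cast_zero]
    fin_cases i
    exacts [h0 hi', h1 hi', h2 hi']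

/-- The three positive factors `4x² - 1` multiply to `4k - 1`. -/
theorem pos_of_ne_zero (P : Points k ℤ) (h : ∀ i, P.1 i ≠ 0) : 0 < k := by
  have hpos : ∀ i, 0 < 4 * P.1 i ^ 2 - 1 := fun i => by
    have := pow_pos (abs_pos.mpr (h i)) 2
    rw [sq_abs] at this
    omega
  have hprod := four_sq_sub_one_mul P
  have := mul_pos (hpos 0) (mul_pos (hpos 1) (hpos 2))
  rw [hprod, Int.cast_id] at this
  omega

end MarkoffK3

theorem mainTheorem11 :
    (∀ (k : ℤ) (hk : k ≡ 2 [ZMOD 8]), (MarkoffK3.Points k ℤ).Nonempty →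
      (∀ P : MarkoffK3.AdelicPoints k,
        {p : Nat.Primes | MarkoffK3.invAt
          (MarkoffK3.classA1 k (MarkoffK3.ne_zero_of_modEq hk)) P p ≠ 0}.Finite) ∧
      MarkoffK3.brauerManinSet (MarkoffK3.classA1 k (MarkoffK3.ne_zero_of_modEq hk)) ≠ Set.univ ∧
      MarkoffK3.toBullet ''
        MarkoffK3.brauerManinSet (MarkoffK3.classA1 k (MarkoffK3.ne_zero_of_modEq hk))
          ≠ Set.univ) ∧
    ((34 : ℤ) ≡ 2 [ZMOD 8] ∧ ![1, 1, 2] ∈ MarkoffK3.Points 34 ℤ) ∧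
    (![1, 1, 8] ∈ MarkoffK3.Points 574 ℤ ∧
      (∀ P : MarkoffK3.AdelicPoints 574,
        {p : Nat.Primes | MarkoffK3.invAt
          (MarkoffK3.classA1 574 (by norm_num)) P p ≠ 0}.Finite) ∧
      MarkoffK3.brauerManinSet (MarkoffK3.classA1 574 (by norm_num)) ≠ Set.univ ∧
      MarkoffK3.toBullet '' MarkoffK3.brauerManinSet (MarkoffK3.classA1 574 (by norm_num))
        ≠ Set.univ) := by
  refine ⟨?_, ⟨by decide, ?_⟩, ?_, ?_⟩
  · rintro k hk ⟨v, hv⟩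
    have hk8 : k % 8 = 2 := hk
    obtain ⟨⟨i, hi⟩, ⟨j, hj⟩, h0⟩ := MarkoffK3.parity_of_modEq hk8 ⟨v, hv⟩
    refine MarkoffK3.obstruction _ (MarkoffK3.pos_of_ne_zero ⟨v, hv⟩ h0)
      (MarkoffK3.permPoints ⟨v, hv⟩ i) (MarkoffK3.permPoints ⟨v, hv⟩ j)
      (Or.inl ⟨MarkoffK3.four_sq_sub_one_emod_of_odd hi, hk8⟩) ?_
    have := MarkoffK3.four_sq_sub_one_emod_of_even hj
    change (4 * v j ^ 2 - 1 + k) % 8 = 1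
    change (4 * v j ^ 2 - 1) % 8 = 7 at this
    omega
  · change MarkoffK3.F2 (1 : ℤ) 1 2 = 34
    norm_num [MarkoffK3.F2]
  · change MarkoffK3.F2 (1 : ℤ) 1 8 = 574
    norm_num [MarkoffK3.F2]
  -- Since `574 ≡ 6` mod 8, the even coordinate 8 now gives the non-split algebra and the odd
  -- coordinate the split one, as `3 + 6 ≡ 1`.
  · refine MarkoffK3.obstruction _ (by norm_num)
      ⟨![8, 1, 1], show MarkoffK3.F2 (8 : ℤ) 1 1 = 574 by norm_num [MarkoffK3.F2]⟩
      ⟨![1, 1, 8], show MarkoffK3.F2 (1 : ℤ) 1 8 = 574 by norm_num [MarkoffK3.F2]⟩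
      (Or.inr ?_) ?_ <;> norm_num
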